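/- \textbf{Conventions.} Let $E_m=\{1,\dots,m\}$ and $[i,j]=\{i,\dots,j\}$. For sign vectors $X,Y\in\{-,0,+\}^{E_m}$ and $A\subseteq E_m$, put $X^+=\{e: X(e)=+\}$, $\mathbf S(X,Y)=\{e: X(e)=-Y(e)\neq 0\}$, and let ${}_{-A}X$ be obtained from $X$ by reversing the signs on $A$. Let $\mathrm T^{(+)}=(+\cdots+)$ and $\mathrm T^{(-)}=(-\cdots-)$. For a set $\mathcal P$ of sign vectors let $\mathbf{max}^+(\mathcal P)$ be the set of all $P\in\mathcal P$ such that $P^+$ is inclusion-maximal in $\{R^+:R\in\mathcal P\}$. An oriented matroid is given by its set $\mathcal L$ of covectors; its topes are the covectors of inclusion-maximal support; all oriented matroids are of rank at least $2$. It is simple if it has no loops, parallel or antiparallel elements, and acyclic if it has a nonnegative tope. The reorientation ${}_{-A}\mathcal N$ has the covectors ${}_{-A}X$, $X\in\mathcal L$. Two distinct topes are adjacent in the tope graph if they cover a common covector in the poset of covectors (ordered componentwise by $0<-$, $0<+$). The tope poset based at a tope $B$ is ordered by $T'\preceq T''\iff\mathbf S(B,T')\subseteq\mathbf S(B,T'')$.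 A cycle $(T^0,T^1,\dots,T^{2m-1},T^0)$ in the tope graph is symmetric if $T^{k+m}=-T^k$ for $0\le k\le m-1$. A set $\mathcal K$ of topes is a tope committee if $|\{K\in\mathcal K:K(e)=+\}|>\tfrac12|\mathcal K|$ for every $e\in E_m$. A tope committee $\mathcal K$ is critical if no proper subset of it is a tope committee and, for all $K\in\mathcal K$ and all topes $T$ with $T^+\subsetneq K^+$, the set $(\mathcal K-\{K\})\cup\{T\}$ is not a tope committee. \textbf{Algorithm.} Input: a maximal chain $(R^0=\mathrm T^{(+)},R^1,\dots,R^m=\mathrm T^{(-)})$ in the tope poset based at $\mathrm T^{(+)}$, and an integer $s$. Define labels by $\{\mathfrak l_k\}=\mathbf S(R^{k-1},R^k)$, $1\le k\le m$, and let $\mathcal K_0=\{\mathrm T^{(+)}\}$. For $i=1,\dots,s$: replace $\mathcal K_{i-1}$ by $\{{}_{-\{i\}}K:K\in\mathcal K_{i-1}\}$; let $R=R^k$ where $\mathfrak l_k=i$; form the disjoint union of this set with $\{{}_{-[1,i]}R,\ {}_{-[i,m]}R\}$; then, as long as the current set contains a pair $\{K,T\}$ with $T=-K$, remove such a pair. The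 resulting set is $\mathcal K_i$. Output: $\mathcal K_s$. \textbf{Proposition.} Let $\mathcal N^0$ be a simple acyclic oriented matroid on $E_m$, of rank at least $2$. Let $(R^0=\mathrm T^{(+)},R^1,\dots,R^m=\mathrm T^{(-)})$ be a maximal chain in its tope poset based at $\mathrm T^{(+)}$, let $1\le s\le m$, and let $\mathcal N^s={}_{-[1,s]}\mathcal N^0$. Let $(T^0,T^1,\dots,T^{2m-1},T^0)$ be a symmetric cycle in the tope graph of $\mathcal N^s$ such that $T^k={}_{-[1,s]}R^k$ for $0\le k\le m$. Then the algorithm, run on this chain and $s$, can be carried out, and, whichever opposite pairs it picks, it outputs the set $\mathbf{max}^+(\{T^0,T^1,\dots,T^{2m-1}\})$, which is a critical tope committee for $\mathcal N^s$. -/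

import Mathlib

/-- Sign vectors on `E`; the signs `-`, `0`, `+` are `-1`, `0`, `1 : SignType`. -/
abbrev SignVec (E : Type*) : Type _ := E → SignType

namespace SignVec

variable {E : Type*}

/-- The support. -/
def support (X : SignVec E) : Set E := {e | X e ≠ 0}

/-- The positive part `X⁺`. -/
def pos (X : SignVec E) : Set E := {e | X e = 1}

/-- The composition `X ∘ Y`. -/
def comp (X Y : SignVec E) : SignVec E := fun e => if X e ≠ 0 then X e else Y e

/-- The separation set `S(X, Y)`. -/
def sep (X Y : SignVec E) : Set E := {e | X e = - Y e ∧ X e ≠ 0}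

/-- `X` with the signs on `A` reversed. -/
def reorient [DecidableEq E] (A : Finset E) (X : SignVec E) : SignVec E :=
  fun e => if e ∈ A then - X e else X e

/-- The positive sign vector `(+ + ⋯ +)`. -/
def allPos (E : Type*) : SignVec E := fun _ => 1

/-- The members of `P` whose positive part is inclusion-maximal among the positive parts of the
members of `P`. -/
def bmaxPos (P : Set (SignVec E)) : Set (SignVec E) :=
  {X | X ∈ P ∧ Maximal (fun S => S ∈ pos '' P) X.pos}

theorem reorient_reorient [DecidableEq E] (A : Finset E) (X : SignVec E) :
    reorient A (reorient A X) = X := by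
  funext e
  by_cases h : e ∈ A <;> simp [reorient, h]

theorem reorient_neg [DecidableEq E] (A : Finset E) (X : SignVec E) :
    reorient A (-X) = -reorient A X := by
  funext e
  change (if e ∈ A then - -X e else -X e) = -(if e ∈ A then -X e else X e)
  split_ifs <;> rfl

theorem reorient_comp [DecidableEq E] (A : Finset E) (X Y : SignVec E) :
    reorient A (comp X Y) = comp (reorient A X) (reorient A Y) := by
  funext e
  by_cases h : e ∈ A <;> by_cases h' : X e = 0 <;> simp [reorient, comp, h, h']

theorem sep_reorient [DecidableEq E] (A : Finset E) (X Y : SignVec E) :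
    sep (reorient A X) (reorient A Y) = sep X Y := by
  ext e
  by_cases h : e ∈ A
  · have h₁ : -X e = - -Y e ↔ X e = -Y e := neg_inj
    simp only [sep, reorient, h, if_true, Set.mem_ofPred_eq, h₁, ne_eq, SignType.neg_eq_zero_iff]
  · simp only [sep, reorient, h, if_false, Set.mem_ofPred_eq]

end SignVec

/-- An oriented matroid on `E`, given by its covectors. -/
structure OrientedMatroid (E : Type*) where
  /-- The set of covectors. -/
  covectors : Set (SignVec E)
  zero_mem : 0 ∈ covectors
  neg_mem : ∀ X ∈ covectors, -X ∈ covectors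
  comp_mem : ∀ X ∈ covectors, ∀ Y ∈ covectors, X.comp Y ∈ covectors
  elim : ∀ X ∈ covectors, ∀ Y ∈ covectors, ∀ e ∈ X.sep Y,
    ∃ Z ∈ covectors, Z e = 0 ∧ ∀ f ∉ X.sep Y, Z f = X.comp Y f ∧ Z f = Y.comp X f

namespace OrientedMatroid

variable {E : Type*}

/-- The poset of covectors of `M`. -/
@[ext] structure FacePoset (M : OrientedMatroid E) where
  val : SignVec E
  mem : val ∈ M.covectors

/-- The face order: signs are ordered by `0 < -` and `0 < +` only (with `-` and `+`
incomparable), and sign vectors are compared componentwise. -/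
instance (M : OrientedMatroid E) : PartialOrder M.FacePoset where
  le X Y := ∀ e, X.val e = 0 ∨ X.val e = Y.val e
  le_refl _ _ := Or.inr rfl
  le_trans X Y Z h₁ h₂ e := by
    rcases h₁ e with h | h
    · exact Or.inl h
    · rcases h₂ e with h' | h'
      · exact Or.inl (h.trans h')
      · exact Or.inr (h.trans h')
  le_antisymm X Y h₁ h₂ := by
    ext e
    rcases h₁ e with h | h
    · rcases h₂ e with h' | h'
      · exact h.trans h'.symm
      · exact h'.symm
    · exact h

/-- The rank: the length of the poset of covectors under the face order. -/
noncomputable def rank (M : OrientedMatroid E) : WithBot ℕ∞ := Order.krullDim M.FacePoset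

/-- The topes: the covectors with inclusion-maximal support. -/
def topes (M : OrientedMatroid E) : Set (SignVec E) :=
  {T | T ∈ M.covectors ∧ ∀ X ∈ M.covectors, T.support ⊆ X.support → X.support ⊆ T.support}

/-- A loop: an element on which all topes vanish. -/
def IsLoop (M : OrientedMatroid E) (e : E) : Prop := ∀ T ∈ M.topes, T e = 0

def Parallel (M : OrientedMatroid E) (e f : E) : Prop :=
  e ≠ f ∧ ∀ X ∈ M.covectors, X e = X f

def Antiparallel (M : OrientedMatroid E) (e f : E) : Prop :=
  e ≠ f ∧ ∀ X ∈ M.covectors, X e = - X f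

/-- Simple: no loops, no parallel elements and no antiparallel elements. -/
def IsSimple (M : OrientedMatroid E) : Prop :=
  (∀ e, ¬ M.IsLoop e) ∧ (∀ e f, ¬ M.Parallel e f) ∧ ∀ e f, ¬ M.Antiparallel e f

/-- Acyclic: some tope is nonnegative. -/
def IsAcyclic (M : OrientedMatroid E) : Prop := ∃ T ∈ M.topes, ∀ e, T e = 0 ∨ T e = 1

/-- The reorientation of `M` on `A`. -/
def reorient [DecidableEq E] (M : OrientedMatroid E) (A : Finset E) : OrientedMatroid E where
  covectors := SignVec.reorient A '' M.covectors
  zero_mem := ⟨0, M.zero_mem, by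
    funext e
    change (if e ∈ A then -(0 : SignType) else 0) = 0
    split_ifs <;> rfl⟩
  neg_mem := by
    rintro _ ⟨X, hX, rfl⟩
    exact ⟨-X, M.neg_mem X hX, SignVec.reorient_neg A X⟩
  comp_mem := by
    rintro _ ⟨X, hX, rfl⟩ _ ⟨Y, hY, rfl⟩
    exact ⟨X.comp Y, M.comp_mem X hX Y hY, SignVec.reorient_comp A X Y⟩
  elim := by
    rintro _ ⟨X, hX, rfl⟩ _ ⟨Y, hY, rfl⟩ e he
    rw [SignVec.sep_reorient] at he ⊢
    obtain ⟨Z, hZ, hZe, hZf⟩ := M.elim X hX Y hY e he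
    refine ⟨_, ⟨Z, hZ, rfl⟩, by simp [SignVec.reorient, hZe], fun f hf => ?_⟩
    rw [← SignVec.reorient_comp, ← SignVec.reorient_comp]
    obtain ⟨h₁, h₂⟩ := hZf f hf
    exact ⟨by simp only [SignVec.reorient, h₁], by simp only [SignVec.reorient, h₂]⟩

/-- The tope graph: distinct topes are adjacent if they cover a common covector (a subtope) in
the poset of covectors. -/
def topeGraph (M : OrientedMatroid E) : SimpleGraph M.topes where
  Adj T T' := T ≠ T' ∧ ∃ H : M.FacePoset, H ⋖ ⟨T, T.2.1⟩ ∧ H ⋖ ⟨T', T'.2.1⟩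
  symm := ⟨fun _ _ h => ⟨h.1.symm, h.2.imp fun _ hH => hH.symm⟩⟩
  loopless := ⟨fun _ h => h.1 rfl⟩

/-- The covering relation of the tope poset based at `B`, in which `T ≼ T'` means
`S(B, T) ⊆ S(B, T')`. -/
def TopeCovers (M : OrientedMatroid E) (B T T' : SignVec E) : Prop :=
  T ∈ M.topes ∧ T' ∈ M.topes ∧ B.sep T ⊂ B.sep T' ∧
    ∀ U ∈ M.topes, ¬ (B.sep T ⊂ B.sep U ∧ B.sep U ⊂ B.sep T')

/-- `K` is a tope `p`-committee for `M`. -/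
def IsTopePCommittee (M : OrientedMatroid E) (p : ℚ) (K : Finset (SignVec E)) : Prop :=
  (K : Set (SignVec E)) ⊆ M.topes ∧
    ∀ e, p * (K.card : ℚ) < ((K.filter fun X => X e = 1).card : ℚ)

/-- `K` is a tope committee for `M`. -/
def IsTopeCommittee (M : OrientedMatroid E) (K : Finset (SignVec E)) : Prop :=
  M.IsTopePCommittee (1 / 2) K

/-- `K` is a minimal tope committee for `M`. -/
def IsMinimalTopeCommittee (M : OrientedMatroid E) (K : Finset (SignVec E)) : Prop :=
  M.IsTopeCommittee K ∧ ∀ K' ⊂ K, ¬ M.IsTopeCommittee K'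

/-- `K` is a critical tope committee for `M`. -/
def IsCriticalTopeCommittee [Fintype E] [DecidableEq E] (M : OrientedMatroid E)
    (K : Finset (SignVec E)) : Prop :=
  M.IsMinimalTopeCommittee K ∧
    ∀ X ∈ K, ∀ T ∈ M.topes, T.pos ⊂ X.pos → ¬ M.IsTopeCommittee (K \ {X} ∪ {T})

/-! The ground set `E_m = {1, …, m}` is `Fin m`, the element `j ∈ E_m` being the one with value
`j - 1`. So `[1, i]` and `[i, m]` are `Finset.Iic i` and `Finset.Ici i` for `i : Fin m`. -/

/-- The subset `[1, s]` of `E_m`. -/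
def firstElements (m s : ℕ) : Finset (Fin m) := Finset.univ.filter fun e => e.val < s

variable {m : ℕ}

/-- `(R 0, …, R m)` is a maximal chain from `(+ ⋯ +)` to `(- ⋯ -)` in the tope poset of `M` based
at `(+ ⋯ +)`. -/
structure IsMaximalChain (M : OrientedMatroid (Fin m)) (R : ℕ → SignVec (Fin m)) : Prop where
  first : R 0 = SignVec.allPos (Fin m)
  last : R m = -SignVec.allPos (Fin m)
  covers : ∀ k < m, M.TopeCovers (SignVec.allPos (Fin m)) (R k) (R (k + 1))

/-- `(T 0, T 1, …, T (2m - 1), T (2m) = T 0)` is a symmetric cycle in the tope graph of `M`. -/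
structure IsSymmetricCycle (M : OrientedMatroid (Fin m)) (T : ℕ → M.topes) : Prop where
  three_le : 3 ≤ 2 * m
  closed : T (2 * m) = T 0
  inj : Set.InjOn T (Set.Iio (2 * m))
  adj : ∀ k < 2 * m, M.topeGraph.Adj (T k) (T (k + 1))
  symm : ∀ k < m, (T (k + m) : SignVec (Fin m)) = -(T k : SignVec (Fin m))

end OrientedMatroid

section Algorithm

variable {m : ℕ}

/-- `RemoveOpposites K K'`: started on `K`, the loop
`while K contains some {X, Y} with Y = -X do K ← K - {X, Y}` can end with `K'`. -/
inductive RemoveOpposites : Finset (SignVec (Fin m)) → Finset (SignVec (Fin m)) → Prop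
  | done (K : Finset (SignVec (Fin m))) (h : ∀ X ∈ K, -X ∉ K) : RemoveOpposites K K
  | step (K K' : Finset (SignVec (Fin m))) (X : SignVec (Fin m)) (hX : X ∈ K) (hX' : -X ∈ K)
      (h : RemoveOpposites (K \ {X, -X}) K') : RemoveOpposites K K'

/-- `AlgorithmBuilds R i K`: run on the chain `R 0, …, R m`, the algorithm can reach the set `K`
after `i` passes of its main loop. It starts with `{(+ ⋯ +)}`. In the pass for `i ∈ E_m` it
reverses the sign of `i` in all members of the current set, picks the tope `R (k + 1)` of the chain
with `S(R k, R (k + 1)) = {i}`, adds its reorientations on `[1, i]` and on `[i, m]` by a disjoint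
union, and then removes pairs of opposites as long as there are any. -/
inductive AlgorithmBuilds (R : ℕ → SignVec (Fin m)) : ℕ → Finset (SignVec (Fin m)) → Prop
  | start : AlgorithmBuilds R 0 {SignVec.allPos (Fin m)}
  | pass (i : Fin m) (K K' : Finset (SignVec (Fin m))) (k : ℕ)
      (prev : AlgorithmBuilds R i.val K)
      (hk : k < m)
      (label : (R k).sep (R (k + 1)) = {i})
      (disj : Disjoint (K.image (SignVec.reorient {i}))
        {(R (k + 1)).reorient (Finset.Iic i), (R (k + 1)).reorient (Finset.Ici i)})
      (loop : RemoveOpposites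
        (K.image (SignVec.reorient {i}) ∪
          {(R (k + 1)).reorient (Finset.Iic i), (R (k + 1)).reorient (Finset.Ici i)}) K') :
      AlgorithmBuilds R (i.val + 1) K'

end Algorithm

/-! In a simple oriented matroid topes have no zero entries, so each of the m steps of the chain
flips exactly one sign, and the vectors ±R^k form a cycle. If X on the cycle has neighbours obtained
by flipping e and f, then Y(e)Y(f) = -X(e)X(f) for every other Y on the cycle except -X. This
property, `IsCornered`, survives reorientation.

Let K be a subset of such a set, without opposite pairs and with coordinatewise sum (1,…,1)
(`IsBalanced`). Put c = X(e)X(f). Summing Y(e) + cY(f) over Y in K leaves only the contributions of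
±X, so X lies in K exactly when X(e) = X(f) = + (`IsBalanced.mem_iff`). Hence K is unique and equals
the set of members with maximal positive part (`IsBalanced.coe_eq_bmaxPos`); counting gives
criticality (`IsBalanced.isCriticalTopeCommittee`).

The algorithm keeps K balanced (`AlgorithmBuilds.isBalanced`): reversing i turns the i-th sum from 1
into -1, the two added vectors contribute 2 at i and 0 elsewhere, and deleting opposite pairs
changes no sum. So the choice of pairs is irrelevant. -/

namespace SignVec

/-! ### Cornered sets of sign vectors -/

section Basic

variable {E : Type*} [DecidableEq E]

theorem reorient_apply_of_mem {A : Finset E} {e : E} (h : e ∈ A) (X : SignVec E) :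
    reorient A X e = -X e := by simp [reorient, h]

theorem reorient_apply_of_notMem {A : Finset E} {e : E} (h : e ∉ A) (X : SignVec E) :
    reorient A X e = X e := by simp [reorient, h]

theorem reorient_injective (A : Finset E) : Function.Injective (reorient A) :=
  Function.LeftInverse.injective (reorient_reorient A)

theorem reorient_comm (A B : Finset E) (X : SignVec E) :
    reorient A (reorient B X) = reorient B (reorient A X) := by
  funext e
  by_cases hA : e ∈ A <;> by_cases hB : e ∈ B <;> simp [reorient, hA, hB]

theorem reorient_mul_reorient (A : Finset E) (X : SignVec E) (e f : E) :
    reorient A X e * reorient A X f =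
      (if e ∈ A then -1 else 1) * (if f ∈ A then -1 else 1) * (X e * X f) := by
  by_cases he : e ∈ A <;> by_cases hf : f ∈ A <;> simp [reorient, he, hf]

/-- A set of sign vectors without zero entries, closed under negation, in which every member `X`
has two neighbours, differing from it in `e` and in `f` respectively, such that the product of the
signs at `e` and `f` singles out `±X`. The vertex set of a symmetric cycle of topes is such. -/
structure IsCornered (P : Set (SignVec E)) : Prop where
  ne_zero : ∀ X ∈ P, ∀ e, X e ≠ 0
  neg_mem : ∀ X ∈ P, -X ∈ P
  corner : ∀ X ∈ P, ∃ e f, reorient {e} X ∈ P ∧ reorient {f} X ∈ P ∧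
    ∀ Y ∈ P, Y ≠ X → Y ≠ -X → Y e * Y f = -(X e * X f)

/-- Reorientation multiplies the product of the signs at e and f by the same factor for all vectors,
so the corner relation persists. -/
theorem IsCornered.image_reorient {P : Set (SignVec E)} (hP : IsCornered P) (A : Finset E) :
    IsCornered (reorient A '' P) where
  ne_zero := by
    rintro _ ⟨X, hX, rfl⟩ e
    have := hP.ne_zero X hX e
    by_cases h : e ∈ A <;> simpa [reorient, h] using this
  neg_mem := by
    rintro _ ⟨X, hX, rfl⟩
    exact ⟨-X, hP.neg_mem X hX, reorient_neg A X⟩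
  corner := by
    rintro _ ⟨X, hX, rfl⟩
    obtain ⟨e, f, he, hf, h⟩ := hP.corner X hX
    refine ⟨e, f, ⟨_, he, reorient_comm ..⟩, ⟨_, hf, reorient_comm ..⟩, ?_⟩
    rintro _ ⟨Y, hY, rfl⟩ h₁ h₂
    rw [reorient_mul_reorient, reorient_mul_reorient,
      h Y hY (fun h' => h₁ (by rw [h'])) (fun h' => h₂ (by rw [h', reorient_neg])), mul_neg]

/-- If `X` has the sign `-` at `e` then its positive part grows when this sign is reversed. -/
theorem eq_one_of_mem_bmaxPos {P : Set (SignVec E)} {X : SignVec E} {e : E}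
    (hX : X ∈ bmaxPos P) (h0 : X e ≠ 0) (h : reorient {e} X ∈ P) : X e = 1 := by
  by_contra h1
  have hneg : -X e = 1 := by
    generalize X e = a at h0 h1
    revert a; decide
  have hle : X.pos ⊆ (reorient {e} X).pos := by
    intro g hg
    have hge : g ≠ e := by
      rintro rfl
      exact h1 hg
    simpa [pos, reorient, hge] using hg
  have : e ∈ X.pos := hX.2.2 ⟨_, h, rfl⟩ hle (by simpa [pos, reorient] using hneg)
  exact h1 this

end Basic

/-! ### Balanced subsets of cornered sets -/

section Balanced

variable {E : Type*}

/-- A finite set of sign vectors without opposite pairs whose sum is `(1, …, 1)`. -/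
structure IsBalanced (K : Finset (SignVec E)) : Prop where
  neg_notMem : ∀ X ∈ K, -X ∉ K
  sum_eq : ∀ e, ∑ X ∈ K, (X e : ℤ) = 1

theorem IsBalanced.two_mul_card_filter {K : Finset (SignVec E)} (hK : IsBalanced K)
    (h0 : ∀ X ∈ K, ∀ e, X e ≠ 0) (e : E) :
    2 * (K.filter fun X => X e = 1).card = K.card + 1 := by
  have h : ∀ X ∈ K, (X e : ℤ) = 2 * (if X e = 1 then 1 else 0) - 1 := by
    intro X hX
    have := h0 X hX e
    generalize X e = a at this
    revert a; decide
  have hsum := hK.sum_eq e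
  rw [Finset.sum_congr rfl h, Finset.sum_sub_distrib, ← Finset.mul_sum, Finset.sum_boole,
    Finset.sum_const, nsmul_eq_mul, mul_one] at hsum
  lia

variable [Fintype E] [DecidableEq E] {P : Set (SignVec E)} {K : Finset (SignVec E)}

/-- With c = X(e)X(f), summing over K gives 1 + c = 2X(e)([X ∈ K] - [-X ∈ K]), and at most one of ±X
lies in K. -/
theorem IsBalanced.mem_iff (hK : IsBalanced K) (hP : IsCornered P) (hKP : (K : Set _) ⊆ P)
    {X : SignVec E} (hX : X ∈ P) {e f : E}
    (h : ∀ Y ∈ P, Y ≠ X → Y ≠ -X → Y e * Y f = -(X e * X f)) :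
    X ∈ K ↔ X e = 1 ∧ X f = 1 := by
  have hXe := hP.ne_zero X hX e
  have hXf := hP.ne_zero X hX f
  have hne : X ≠ -X := by
    intro h'
    have := congrFun h' e
    rw [Pi.neg_apply] at this
    generalize X e = a at this hXe
    revert a; decide
  -- For Y ≠ ±X the corner relation says cY(f) = -Y(e), so the left side vanishes; at ±X the two
  -- summands agree.
  have key : ∀ Y ∈ K, (Y e : ℤ) + ((X e * X f : SignType) : ℤ) * (Y f : ℤ) =
      (if Y = X then 2 * (X e : ℤ) else 0) + (if Y = -X then -2 * (X e : ℤ) else 0) := by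
    intro Y hY
    by_cases h₁ : Y = X
    · subst h₁
      rw [if_pos rfl, if_neg hne]
      generalize Y e = a at hXe
      generalize Y f = b at hXf
      revert a b; decide
    by_cases h₂ : Y = -X
    · subst h₂
      rw [if_neg h₁, if_pos rfl]
      simp only [Pi.neg_apply]
      generalize X e = a at hXe
      generalize X f = b at hXf
      revert a b; decide
    · have hm := h Y (hKP hY) h₁ h₂
      have h0 := hP.ne_zero Y (hKP hY) f
      rw [if_neg h₁, if_neg h₂]
      generalize X e * X f = c at hm
      generalize Y e = a at hm
      generalize Y f = b at hm h0
      revert a b c; decide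
  have hsum := Finset.sum_congr rfl key
  rw [Finset.sum_add_distrib, Finset.sum_add_distrib, ← Finset.mul_sum, hK.sum_eq, hK.sum_eq,
    Finset.sum_ite_eq', Finset.sum_ite_eq'] at hsum
  by_cases hmem : X ∈ K
  · have hmem' := hK.neg_notMem X hmem
    simp only [hmem, hmem', if_true, if_false, true_iff] at hsum ⊢
    generalize X e = a at hXe hsum
    generalize X f = b at hXf hsum
    revert a b; decide
  · simp only [hmem, if_false, false_iff] at hsum ⊢
    by_cases hmem' : -X ∈ K
    · simp only [hmem', if_true] at hsum
      generalize X e = a at hXe hsum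
      generalize X f = b at hXf hsum
      revert a b; decide
    · simp only [hmem', if_false] at hsum
      generalize X e = a at hXe hsum
      generalize X f = b at hXf hsum
      revert a b; decide

/-- A vector positive at both corner elements is maximal, since no other member is positive at both.
Conversely a maximal vector is positive at both, as otherwise a neighbour has larger positive part.
-/
theorem IsBalanced.coe_eq_bmaxPos (hK : IsBalanced K) (hP : IsCornered P)
    (hKP : (K : Set _) ⊆ P) : (K : Set (SignVec E)) = bmaxPos P := by
  ext X
  constructor
  · intro hXK
    have hX := hKP hXK
    obtain ⟨e, f, -, -, h⟩ := hP.corner X hX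
    obtain ⟨he, hf⟩ := (hK.mem_iff hP hKP hX h).1 hXK
    refine ⟨hX, ⟨X, hX, rfl⟩, ?_⟩
    rintro _ ⟨Y, hY, rfl⟩ hle
    have hYe : Y e = 1 := hle he
    have hYf : Y f = 1 := hle hf
    by_cases h₁ : Y = X
    · rw [h₁]
    by_cases h₂ : Y = -X
    · rw [h₂, Pi.neg_apply, he] at hYe
      exact absurd hYe (by decide)
    · have := h Y hY h₁ h₂
      rw [hYe, hYf, he, hf] at this
      exact absurd this (by decide)
  · intro hX
    obtain ⟨e, f, he, hf, h⟩ := hP.corner X hX.1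
    exact (hK.mem_iff hP hKP hX.1 h).2
      ⟨eq_one_of_mem_bmaxPos hX (hP.ne_zero X hX.1 e) he,
        eq_one_of_mem_bmaxPos hX (hP.ne_zero X hX.1 f) hf⟩

/-- Every element is positive in exactly (|K| + 1)/2 members, the least possible majority. -/
theorem IsBalanced.isCriticalTopeCommittee (hK : IsBalanced K) (hP : IsCornered P)
    (hKP : (K : Set _) ⊆ P) {M : OrientedMatroid E} (hPM : P ⊆ M.topes) :
    M.IsCriticalTopeCommittee K := by
  have hcard := hK.two_mul_card_filter fun X hX => hP.ne_zero X (hKP hX)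
  refine ⟨⟨⟨hKP.trans hPM, fun e => ?_⟩, fun K' hK' hcomm => ?_⟩, ?_⟩
  · have : (2 : ℚ) * ((K.filter fun X => X e = 1).card : ℚ) = K.card + 1 := by
      exact_mod_cast hcard e
    linarith
  · obtain ⟨X, hXK, hXK'⟩ := Finset.exists_of_ssubset hK'
    have hX := hKP hXK
    obtain ⟨e, f, -, -, h⟩ := hP.corner X hX
    obtain ⟨he, hf⟩ := (hK.mem_iff hP hKP hX h).1 hXK
    -- Only the omitted X is positive at both corner elements, and two disjoint subsets of K' cannot
    -- both be majorities.
    have hdisj : Disjoint (K'.filter fun Y => Y e = 1) (K'.filter fun Y => Y f = 1) := by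
      rw [Finset.disjoint_filter]
      intro Y hY hYe hYf
      have hYK := hK'.1 hY
      have := h Y (hKP hYK) (fun h' => hXK' (h' ▸ hY)) (fun h' => hK.neg_notMem X hXK (h' ▸ hYK))
      rw [hYe, hYf, he, hf] at this
      exact absurd this (by decide)
    have hle := Finset.card_le_card (Finset.union_subset (Finset.filter_subset (fun Y => Y e = 1) K')
      (Finset.filter_subset (fun Y => Y f = 1) K'))
    rw [Finset.card_union_of_disjoint hdisj] at hle
    have h₁ := hcomm.2 e
    have h₂ := hcomm.2 f
    have h₃ : (((K'.filter fun Y => Y e = 1).card : ℚ) + (K'.filter fun Y => Y f = 1).card) ≤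
        K'.card := by exact_mod_cast hle
    linarith
  · intro X hXK T _ hTX hcomm
    obtain ⟨e, heX, heT⟩ := Set.exists_of_ssubset hTX
    have hfilter : ((K \ {X} ∪ {T}).filter fun Y => Y e = 1) =
        (K.filter fun Y => Y e = 1).erase X := by
      ext Y
      simp only [Finset.mem_filter, Finset.mem_union, Finset.mem_sdiff, Finset.mem_singleton,
        Finset.mem_erase]
      constructor
      · rintro ⟨⟨hY, hYX⟩ | rfl, hYe⟩
        · exact ⟨hYX, hY, hYe⟩
        · exact absurd hYe heT
      · rintro ⟨hYX, hY, hYe⟩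
        exact ⟨Or.inl ⟨hY, hYX⟩, hYe⟩
    have h₁ := hcomm.2 e
    rw [hfilter, Finset.card_erase_of_mem (Finset.mem_filter.2 ⟨hXK, heX⟩)] at h₁
    -- T may already belong to K, so the exchange may lower the size by one; (|K| - 1)/2 positive
    -- members are still too few.
    have h₂ : K.card - 1 ≤ (K \ {X} ∪ {T}).card := by
      rw [← Finset.card_erase_of_mem hXK, Finset.erase_eq]
      exact Finset.card_le_card Finset.subset_union_left
    have h₃ := hcard e
    have h₄ : (K \ {X} ∪ {T}).card < 2 * ((K.filter fun Y => Y e = 1).card - 1) := by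
      have : ((K \ {X} ∪ {T}).card : ℚ) <
          2 * (((K.filter fun Y => Y e = 1).card - 1 : ℕ) : ℚ) := by linarith
      exact_mod_cast this
    lia

end Balanced

end SignVec

/-! ### Removal of opposite pairs -/

namespace RemoveOpposites

variable {m : ℕ} {K K' : Finset (SignVec (Fin m))}

theorem exists_removeOpposites (K : Finset (SignVec (Fin m))) : ∃ K', RemoveOpposites K K' := by
  induction K using Finset.strongInduction with
  | H K ih =>
    by_cases h : ∀ X ∈ K, -X ∉ K
    · exact ⟨K, .done K h⟩
    · push Not at h
      obtain ⟨X, hX, hX'⟩ := h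
      obtain ⟨K', hK'⟩ := ih (K \ {X, -X})
        (Finset.ssubset_iff_subset_ne.2 ⟨Finset.sdiff_subset, fun h => by
          rw [← h] at hX
          simp at hX⟩)
      exact ⟨K', .step K K' X hX hX' hK'⟩

theorem subset (h : RemoveOpposites K K') : K' ⊆ K := by
  induction h with
  | done => exact subset_rfl
  | step _ _ _ _ _ _ ih => exact ih.trans Finset.sdiff_subset

theorem neg_notMem (h : RemoveOpposites K K') : ∀ X ∈ K', -X ∉ K' := by
  induction h with
  | done _ h => exact h
  | step _ _ _ _ _ _ ih => exact ih

theorem sum_eq (h : RemoveOpposites K K') (e : Fin m) :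
    ∑ X ∈ K', (X e : ℤ) = ∑ X ∈ K, (X e : ℤ) := by
  induction h with
  | done => rfl
  | step K K' X hX hX' _ ih =>
    have hsub : {X, -X} ⊆ K := by
      intro Y hY
      rcases Finset.mem_insert.1 hY with rfl | hY
      · exact hX
      · rwa [Finset.mem_singleton.1 hY]
    rw [ih, ← Finset.sum_sdiff hsub, left_eq_add]
    -- If X = -X the pair is a single vector, but that vector is zero.
    by_cases hXX : X = -X
    · have : X e = -X e := congrFun hXX e
      rw [← hXX, Finset.pair_eq_singleton, Finset.sum_singleton]
      generalize X e = a at this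
      revert a; decide
    · rw [Finset.sum_pair hXX, Pi.neg_apply]
      generalize X e = a
      revert a; decide

end RemoveOpposites

/-! ### The chain and its closure to a symmetric cycle -/

namespace OrientedMatroid

variable {E : Type*} {M : OrientedMatroid E}

/-- If T(e) = 0, some tope U is nonzero at the non-loop e, and T ∘ U has larger support than T. -/
theorem IsSimple.ne_zero_of_mem_topes (h : M.IsSimple) {T : SignVec E} (hT : T ∈ M.topes) (e : E) :
    T e ≠ 0 := by
  intro h0
  apply h.1 e
  intro U hU
  by_contra hUe
  have hsub : T.support ⊆ (T.comp U).support := by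
    intro f hf
    have hf' : T f ≠ 0 := hf
    simp [SignVec.support, SignVec.comp, hf']
  have he : e ∈ (T.comp U).support := by
    simpa [SignVec.support, SignVec.comp, h0] using hUe
  exact hT.2 _ (M.comp_mem _ hT.1 _ hU.1) hsub he h0

theorem neg_mem_topes {T : SignVec E} (hT : T ∈ M.topes) : -T ∈ M.topes := by
  have hs : ∀ X : SignVec E, (-X).support = X.support := by
    intro X
    ext e
    simp [SignVec.support]
  refine ⟨M.neg_mem _ hT.1, fun X hX => ?_⟩
  rw [hs]
  exact hT.2 X hX

theorem firstElements_succ {m : ℕ} (i : Fin m) : firstElements m (i + 1) = Finset.Iic i := by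
  refine Finset.ext fun j => ?_
  simp only [firstElements, Finset.mem_filter, Finset.mem_univ, true_and, Finset.mem_Iic,
    Fin.le_def]
  lia

theorem notMem_firstElements {m : ℕ} (i : Fin m) : i ∉ firstElements m i := by
  simp [firstElements]

open SignVec

theorem reorient_singleton_firstElements {m : ℕ} (i : Fin m) (X : SignVec (Fin m)) :
    SignVec.reorient {i} (SignVec.reorient (firstElements m i) X) =
      SignVec.reorient (firstElements m (i + 1)) X := by
  funext j
  by_cases h : j = i
  · subst h
    simp [SignVec.reorient, firstElements]
  · have h' : j.val < i.val ↔ j.val < i.val + 1 := by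
      have := Fin.val_ne_of_ne h
      lia
    simp only [SignVec.reorient, firstElements, Finset.mem_singleton, h, if_false,
      Finset.mem_filter, Finset.mem_univ, true_and, h']

/-- The sets [i, m] and [1, i - 1] are complementary. -/
theorem reorient_Ici {m : ℕ} (i : Fin m) (X : SignVec (Fin m)) :
    SignVec.reorient (Finset.Ici i) X = -SignVec.reorient (firstElements m i) X := by
  funext j
  by_cases h : i ≤ j
  · simp [SignVec.reorient, firstElements, h]
  · simp [SignVec.reorient, firstElements, h, not_le.1 h]

namespace IsMaximalChain

variable {m : ℕ} {M : OrientedMatroid (Fin m)} {R : ℕ → SignVec (Fin m)}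

theorem mem_topes (hR : M.IsMaximalChain R) (hm : 0 < m) {k : ℕ} (hk : k ≤ m) :
    R k ∈ M.topes := by
  rcases hk.lt_or_eq with hk | rfl
  · exact (hR.covers k hk).1
  · have := (hR.covers (k - 1) (by lia)).2.1
    rwa [Nat.sub_add_cancel hm] at this

theorem mem_sep_allPos {X : SignVec (Fin m)} {e : Fin m} :
    e ∈ (allPos (Fin m)).sep X ↔ X e = -1 := by
  simp only [sep, allPos, Set.mem_ofPred_eq]
  generalize X e = a
  revert a; decide

theorem antitone (hR : M.IsMaximalChain R) {e : Fin m} {j k : ℕ} (hjk : j ≤ k) (hk : k ≤ m)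
    (h : R j e = -1) : R k e = -1 := by
  induction k, hjk using Nat.le_induction with
  | base => exact h
  | succ k _ ih =>
    exact mem_sep_allPos.1 ((hR.covers k hk).2.2.1.1 (mem_sep_allPos.2 (ih (by lia))))

/-- The m + 1 sizes increase strictly within {0, …, m}, which leaves no slack; the lower bound
climbs from R^0 and the upper bound descends from R^m. -/
theorem ncard_sep (hR : M.IsMaximalChain R) {k : ℕ} (hk : k ≤ m) :
    ((allPos (Fin m)).sep (R k)).ncard = k := by
  have hlt : ∀ k < m, ((allPos (Fin m)).sep (R k)).ncard <
      ((allPos (Fin m)).sep (R (k + 1))).ncard := fun k hk =>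
    Set.ncard_lt_ncard (hR.covers k hk).2.2.1 (Set.toFinite _)
  have hge : ∀ k ≤ m, k ≤ ((allPos (Fin m)).sep (R k)).ncard := by
    intro k
    induction k with
    | zero => intro _; exact Nat.zero_le _
    | succ k ih => intro hk; exact (ih (by lia)).trans_lt (hlt k hk)
  have hle : ∀ j ≤ m, ((allPos (Fin m)).sep (R (m - j))).ncard ≤ m - j := by
    intro j
    induction j with
    | zero =>
      intro _
      calc _ ≤ (Set.univ : Set (Fin m)).ncard := Set.ncard_le_ncard (Set.subset_univ _)
        _ = m := by simp [Set.ncard_univ]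
    | succ j ih =>
      intro hj
      have h₁ := hlt (m - (j + 1)) (by lia)
      rw [show m - (j + 1) + 1 = m - j by lia] at h₁
      have h₂ := ih (by lia)
      lia
  have := hle (m - k) (by lia)
  rw [show m - (m - k) = k by lia] at this
  exact this.antisymm (hge k hk)

/-- Consecutive topes of the chain differ in a single element, the label of the step. -/
theorem exists_label (hR : M.IsMaximalChain R) (hM : M.IsSimple) {k : ℕ} (hk : k < m) :
    ∃ e, R (k + 1) = SignVec.reorient {e} (R k) ∧ (∀ j ≤ k, R j e = 1) ∧
      ∀ j, k < j → j ≤ m → R j e = -1 := by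
  have hm : 0 < m := by lia
  have hone : ∀ j ≤ m, ∀ f, R j f ≠ -1 → R j f = 1 := by
    intro j hj f h
    have h0 := hM.ne_zero_of_mem_topes (hR.mem_topes hm hj) f
    generalize R j f = a at h h0
    revert a; decide
  have hss := (hR.covers k hk).2.2.1
  have hdiff : ((allPos (Fin m)).sep (R (k + 1)) \ (allPos (Fin m)).sep (R k)).ncard = 1 := by
    rw [Set.ncard_sdiff hss.1, hR.ncard_sep (show k + 1 ≤ m from hk), hR.ncard_sep hk.le]
    lia
  obtain ⟨e, he⟩ := Set.ncard_eq_one.1 hdiff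
  have hmem : ∀ f, f = e ↔ R (k + 1) f = -1 ∧ R k f ≠ -1 := by
    intro f
    rw [← Set.mem_singleton_iff, ← he, Set.mem_sdiff, mem_sep_allPos, mem_sep_allPos]
  obtain ⟨he₁, he₀⟩ := (hmem e).1 rfl
  refine ⟨e, ?_, fun j hj => hone j (by lia) e fun h => he₀ (hR.antitone hj hk.le h),
    fun j hj hjm => hR.antitone hj hjm he₁⟩
  funext f
  by_cases hf : f = e
  · subst hf
    rw [reorient_apply_of_mem (Finset.mem_singleton_self f), he₁, hone k hk.le f he₀]
  · rw [reorient_apply_of_notMem (by simpa using hf)]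
    by_cases hk' : R k f = -1
    · rw [hk', hR.antitone (Nat.le_succ k) hk hk']
    · rw [hone k hk.le f hk']
      exact hone _ hk f fun h => hf ((hmem f).2 ⟨h, hk'⟩)

/-- The cycle of topes `±R k` closing up the chain. -/
def cycle (R : ℕ → SignVec (Fin m)) : Set (SignVec (Fin m)) :=
  {X | ∃ k ≤ m, X = R k ∨ X = -R k}

theorem neg_mem_cycle {X : SignVec (Fin m)} (hX : X ∈ cycle R) : -X ∈ cycle R := by
  obtain ⟨k, hk, rfl | rfl⟩ := hX
  · exact ⟨k, hk, Or.inr rfl⟩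
  · exact ⟨k, hk, Or.inl (neg_neg _)⟩

theorem last_eq_neg_first (hR : M.IsMaximalChain R) : R m = -R 0 := by
  rw [hR.first, hR.last]

theorem isCornered_cycle (hR : M.IsMaximalChain R) (hM : M.IsSimple) (hm : 0 < m) :
    IsCornered (cycle R) where
  ne_zero := by
    rintro _ ⟨k, hk, rfl | rfl⟩ e
    · exact hM.ne_zero_of_mem_topes (hR.mem_topes hm hk) e
    · exact hM.ne_zero_of_mem_topes (neg_mem_topes (hR.mem_topes hm hk)) e
  neg_mem _ := neg_mem_cycle
  corner := by
    have hend := hR.last_eq_neg_first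
    have hprod : ∀ (X : SignVec (Fin m)) (e f : Fin m), (-X) e * (-X) f = X e * X f :=
      fun X e f => neg_mul_neg _ _
    have main : ∀ k < m, ∃ e f, SignVec.reorient {e} (R k) ∈ cycle R ∧
        SignVec.reorient {f} (R k) ∈ cycle R ∧ ∀ Y ∈ cycle R, Y ≠ R k → Y ≠ -R k →
          Y e * Y f = -(R k e * R k f) := by
      intro k hk
      obtain ⟨f, hf, hf₀, hf₁⟩ := hR.exists_label hM hk
      obtain rfl | hk0 := Nat.eq_zero_or_pos k
      -- Since R^m = -R^0, the predecessor of R^0 on the cycle is -R^(m-1), and e is the last label.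
      · obtain ⟨e, he, he₀, he₁⟩ := hR.exists_label hM (show m - 1 < m by lia)
        rw [Nat.sub_add_cancel hm] at he
        refine ⟨e, f, ⟨m - 1, by lia, Or.inr ?_⟩, ⟨1, hm, Or.inl hf.symm⟩, ?_⟩
        · rw [← neg_neg (R 0), ← hend, he, reorient_neg, reorient_reorient]
        · have : ∀ j ≤ m, R j ≠ R 0 → R j ≠ -R 0 → R j e * R j f = -(R 0 e * R 0 f) := by
            intro j hj h₁ h₂
            have hj0 : j ≠ 0 := by rintro rfl; exact h₁ rfl
            have hjm : j ≠ m := by rintro rfl; exact h₂ hend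
            rw [he₀ j (by lia), hf₁ j (by lia) hj, he₀ 0 (by lia), hf₀ 0 le_rfl]
            decide
          rintro _ ⟨j, hj, rfl | rfl⟩ h₁ h₂
          · exact this j hj h₁ h₂
          · rw [hprod]
            exact this j hj (fun h => h₂ (by rw [h])) (fun h => h₁ (by rw [h, neg_neg]))
      · obtain ⟨e, he, he₀, he₁⟩ := hR.exists_label hM (show k - 1 < m by lia)
        rw [Nat.sub_add_cancel hk0] at he
        refine ⟨e, f, ⟨k - 1, by lia, Or.inl ?_⟩, ⟨k + 1, hk, Or.inl hf.symm⟩, ?_⟩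
        · rw [he, reorient_reorient]
        -- The labels e and f flip just before and just after R^k, so the signs at e and f differ in
        -- R^k and agree in every other R^j.
        · have : ∀ j ≤ m, R j ≠ R k → R j e * R j f = -(R k e * R k f) := by
            intro j hj h₁
            rw [he₁ k (by lia) hk.le, hf₀ k le_rfl]
            rcases lt_trichotomy j k with h | rfl | h
            · rw [he₀ j (by lia), hf₀ j h.le]
              decide
            · exact absurd rfl h₁
            · rw [he₁ j (by lia) hj, hf₁ j h hj]
              decide
          rintro _ ⟨j, hj, rfl | rfl⟩ h₁ h₂
          · exact this j hj h₁
          · rw [hprod]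
            exact this j hj (fun h => h₂ (by rw [h]))
    have main' : ∀ k < m, ∀ X, X = R k ∨ X = -R k → ∃ e f, SignVec.reorient {e} X ∈ cycle R ∧
        SignVec.reorient {f} X ∈ cycle R ∧ ∀ Y ∈ cycle R, Y ≠ X → Y ≠ -X →
          Y e * Y f = -(X e * X f) := by
      rintro k hk _ (rfl | rfl)
      · exact main k hk
      · obtain ⟨e, f, he, hf, h⟩ := main k hk
        refine ⟨e, f, ?_, ?_, fun Y hY h₁ h₂ => ?_⟩
        · rw [reorient_neg]
          exact neg_mem_cycle he
        · rw [reorient_neg]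
          exact neg_mem_cycle hf
        · rw [hprod]
          exact h Y hY (by rwa [neg_neg] at h₂) h₁
    rintro X ⟨k, hk, hX⟩
    rcases hk.lt_or_eq with hk | rfl
    · exact main' k hk X hX
    · rw [hend, neg_neg] at hX
      exact main' 0 hm X hX.symm

end IsMaximalChain

end OrientedMatroid

/-! ### The invariant and feasibility of the algorithm -/

namespace AlgorithmBuilds

open OrientedMatroid OrientedMatroid.IsMaximalChain SignVec

variable {m : ℕ} {M : OrientedMatroid (Fin m)} {R : ℕ → SignVec (Fin m)}

/-- With X = R^(k-1) and label i at step k, the second added vector becomes the reorientation on [1,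
i] of -R^(k-1), a member of the new cycle. -/
theorem reorient_Ici_reorient_singleton (i : Fin m) (X : SignVec (Fin m)) :
    SignVec.reorient (Finset.Ici i) (SignVec.reorient {i} X) =
      SignVec.reorient (firstElements m (i + 1)) (-X) := by
  rw [reorient_Ici, reorient_comm, reorient_singleton_firstElements, reorient_neg]

/-- The members of the set from which the `i`-th pass of the algorithm removes opposite pairs lie
on the `i`-th reoriented cycle. -/
theorem pass_subset {i : Fin m} {K : Finset (SignVec (Fin m))}
    (hK : (K : Set _) ⊆ SignVec.reorient (firstElements m i) '' cycle R) {k : ℕ} (hk : k < m)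
    (hstep : R (k + 1) = SignVec.reorient {i} (R k)) :
    ((K.image (SignVec.reorient {i}) ∪ {(R (k + 1)).reorient (Finset.Iic i),
      (R (k + 1)).reorient (Finset.Ici i)} : Finset (SignVec (Fin m))) : Set _) ⊆
      SignVec.reorient (firstElements m (i + 1)) '' cycle R := by
  intro X hX
  simp only [Finset.coe_union, Finset.coe_image, Finset.coe_insert, Finset.coe_singleton] at hX
  rcases hX with ⟨Y, hY, rfl⟩ | rfl | rfl
  · obtain ⟨Z, hZ, rfl⟩ := hK hY
    exact ⟨Z, hZ, (reorient_singleton_firstElements i Z).symm⟩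
  · exact ⟨R (k + 1), ⟨k + 1, hk, Or.inl rfl⟩, by rw [firstElements_succ]⟩
  · refine ⟨-R k, ⟨k, hk.le, Or.inr rfl⟩, ?_⟩
    rw [hstep, reorient_Ici_reorient_singleton]

/-- A pass of the algorithm preserves the sum of the members of the current set. -/
theorem pass_sum_eq (hm : 2 ≤ m) {i : Fin m} {K : Finset (SignVec (Fin m))}
    (hK : ∀ j, ∑ X ∈ K, (X j : ℤ) = 1) {k : ℕ}
    (hstep : R (k + 1) = SignVec.reorient {i} (R k)) (h0 : ∀ j, R k j ≠ 0) (hi : R k i = 1)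
    (disj : Disjoint (K.image (SignVec.reorient {i}))
      {(R (k + 1)).reorient (Finset.Iic i), (R (k + 1)).reorient (Finset.Ici i)}) (j : Fin m) :
    ∑ X ∈ K.image (SignVec.reorient {i}) ∪
      {(R (k + 1)).reorient (Finset.Iic i), (R (k + 1)).reorient (Finset.Ici i)}, (X j : ℤ) = 1 := by
  -- The two added vectors are opposite at every element other than i; such an element exists
  -- because m ≥ 2.
  have hne : (R (k + 1)).reorient (Finset.Iic i) ≠ (R (k + 1)).reorient (Finset.Ici i) := by
    rw [← firstElements_succ, hstep, reorient_Ici_reorient_singleton]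
    intro h
    have : Nontrivial (Fin m) := Fin.nontrivial_iff_two_le.2 hm
    obtain ⟨j, hj⟩ := exists_ne i
    have := congrFun (reorient_injective _ h) j
    rw [reorient_apply_of_notMem (by simpa using hj), Pi.neg_apply] at this
    have h0j := h0 j
    generalize R k j = a at this h0j
    revert a; decide
  rw [Finset.sum_union disj, Finset.sum_image (reorient_injective {i}).injOn, Finset.sum_pair hne,
    ← firstElements_succ, hstep, reorient_Ici_reorient_singleton, reorient_neg]
  by_cases hj : j = i
  · subst hj
    have hmem : j ∈ firstElements m (j + 1) := by simp [firstElements]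
    have hsum : ∑ X ∈ K, (SignVec.reorient {j} X j : ℤ) = -1 := by
      rw [← hK j, ← Finset.sum_neg_distrib]
      refine Finset.sum_congr rfl fun X _ => ?_
      rw [reorient_apply_of_mem (Finset.mem_singleton_self j)]
      generalize X j = a
      revert a; decide
    rw [hsum, Pi.neg_apply, reorient_apply_of_mem hmem, reorient_apply_of_mem hmem,
      reorient_apply_of_mem (Finset.mem_singleton_self j), hi]
    decide
  · have hj' : j ∉ ({i} : Finset (Fin m)) := by simpa using hj
    have hsum : ∑ X ∈ K, (SignVec.reorient {i} X j : ℤ) = 1 := by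
      rw [← hK j]
      exact Finset.sum_congr rfl fun X _ => by rw [reorient_apply_of_notMem hj']
    rw [hsum, Pi.neg_apply, reorient_comm, reorient_apply_of_notMem hj']
    generalize SignVec.reorient _ (R k) j = a
    revert a; decide

/-- The sets built by the algorithm are balanced subsets of the reoriented cycles. -/
theorem isBalanced (hR : M.IsMaximalChain R) (hM : M.IsSimple) (hm : 2 ≤ m) {i : ℕ}
    {K : Finset (SignVec (Fin m))} (h : AlgorithmBuilds R i K) :
    (K : Set _) ⊆ SignVec.reorient (firstElements m i) '' cycle R ∧ IsBalanced K := by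
  induction h with
  | start =>
    refine ⟨?_, ?_, ?_⟩
    · intro X hX
      rw [Finset.coe_singleton, Set.mem_singleton_iff] at hX
      subst hX
      exact ⟨R 0, ⟨0, Nat.zero_le _, Or.inl rfl⟩, by
        funext j; simp [SignVec.reorient, firstElements, hR.first]⟩
    · simp only [Finset.mem_singleton, forall_eq]
      intro h
      exact absurd (congrFun h ⟨0, by lia⟩) (by simp [allPos])
    · intro e
      simp [allPos]
  | pass i K K' k _ hk label disj loop ih =>
    obtain ⟨e, hstep, he, -⟩ := hR.exists_label hM hk
    have hmem : i ∈ (R k).sep (R (k + 1)) := by rw [label]; rfl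
    obtain rfl : i = e := by
      by_contra hne
      obtain ⟨h₁, h₂⟩ := hmem
      rw [hstep, reorient_apply_of_notMem (by simpa using hne)] at h₁
      generalize R k i = a at h₁ h₂
      revert a; decide
    refine ⟨fun X hX => pass_subset ih.1 hk hstep (loop.subset hX), loop.neg_notMem, fun j => ?_⟩
    rw [loop.sum_eq]
    exact pass_sum_eq hm ih.2.sum_eq hstep
      (hM.ne_zero_of_mem_topes (hR.mem_topes (by lia) hk.le)) (he k le_rfl) disj j

/-- Were i never the label, its sign would stay + along the whole chain. -/
theorem exists_step (hR : M.IsMaximalChain R) (hM : M.IsSimple) (i : Fin m) :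
    ∃ k < m, R (k + 1) = SignVec.reorient {i} (R k) ∧ R k i = 1 := by
  have hm : 0 < m := i.pos
  by_contra! hcon
  have hall : ∀ k ≤ m, R k i = 1 := by
    intro k
    induction k with
    | zero => intro _; rw [hR.first]; rfl
    | succ k ih =>
      intro hk
      obtain ⟨e, hstep, -, -⟩ := hR.exists_label hM (show k < m from hk)
      have hne : i ≠ e := by
        rintro rfl
        exact hcon k hk hstep (ih (by lia))
      rw [hstep, reorient_apply_of_notMem (by simpa using hne)]
      exact ih (by lia)
  have := hall m le_rfl
  rw [hR.last] at this
  exact absurd this (by simp [allPos])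

/-- The algorithm can be carried out. -/
theorem exists_algorithmBuilds (hR : M.IsMaximalChain R) (hM : M.IsSimple) (hm : 2 ≤ m) {s : ℕ}
    (hs : s ≤ m) : ∃ K, AlgorithmBuilds R s K := by
  induction s with
  | zero => exact ⟨_, .start⟩
  | succ s ih =>
    obtain ⟨K, hK⟩ := ih (by lia)
    obtain ⟨i, rfl⟩ : ∃ i : Fin m, i.val = s := ⟨⟨s, hs⟩, rfl⟩
    obtain ⟨k, hk, hstep, hi⟩ := exists_step hR hM i
    obtain ⟨hsub, hbal⟩ := isBalanced hR hM hm hK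
    have hP := (hR.isCornered_cycle hM (by lia)).image_reorient (firstElements m i)
    have h0 := hM.ne_zero_of_mem_topes (hR.mem_topes (by lia) hk.le)
    have hmem : R k ∈ cycle R := ⟨k, hk.le, Or.inl rfl⟩
    have hmem' : R (k + 1) ∈ cycle R := ⟨k + 1, hk, Or.inl rfl⟩
    -- K is already known to consist of vectors with maximal positive part, so a member whose
    -- neighbour across i is on the cycle is positive at i.
    have hone : ∀ X ∈ K, SignVec.reorient {i} X ∈
        SignVec.reorient (firstElements m i) '' cycle R → X i = 1 := by
      intro X hX hX'
      have hX₁ := hX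
      rw [← Finset.mem_coe, hbal.coe_eq_bmaxPos hP hsub] at hX₁
      exact eq_one_of_mem_bmaxPos hX₁ (hP.ne_zero X (hsub hX) i) hX'
    have label : (R k).sep (R (k + 1)) = {i} := by
      ext j
      rw [hstep, Set.mem_singleton_iff]
      by_cases hj : j = i
      · subst hj
        simp [sep, SignVec.reorient, hi]
      · have := h0 j
        simp only [sep, Set.mem_ofPred_eq, hj, iff_false,
          reorient_apply_of_notMem (show j ∉ ({i} : Finset (Fin m)) by simpa using hj)]
        generalize R k j = a at this
        revert a; decide
    -- A common vector would come from a member of K equal to R^(k+1) or -R^k up to reorientation on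
    -- [1, i - 1]. Its neighbour across i is on the cycle, yet its sign at i is -.
    have disj : Disjoint (K.image (SignVec.reorient {i}))
        {(R (k + 1)).reorient (Finset.Iic i), (R (k + 1)).reorient (Finset.Ici i)} := by
      rw [Finset.disjoint_right]
      intro Y hY hYK
      obtain ⟨X, hX, rfl⟩ := Finset.mem_image.1 hYK
      have hi' : SignVec.reorient {i} (R k) i = -1 := by
        rw [reorient_apply_of_mem (Finset.mem_singleton_self i), hi]
      rcases Finset.mem_insert.1 hY with h | h
      · rw [← firstElements_succ, ← reorient_singleton_firstElements] at h
        obtain rfl := reorient_injective _ h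
        have := hone _ hX (by
          rw [reorient_comm, hstep, reorient_reorient]
          exact ⟨_, hmem, rfl⟩)
        rw [reorient_apply_of_notMem (notMem_firstElements i), hstep, hi'] at this
        exact absurd this (by decide)
      · rw [Finset.mem_singleton, hstep, reorient_Ici_reorient_singleton,
          ← reorient_singleton_firstElements] at h
        obtain rfl := reorient_injective _ h
        have := hone _ hX (by
          rw [reorient_comm, reorient_neg {i}, ← hstep]
          exact ⟨_, neg_mem_cycle hmem', rfl⟩)
        rw [reorient_apply_of_notMem (notMem_firstElements i), Pi.neg_apply, hi] at this
        exact absurd this (by decide)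
    obtain ⟨K', hK'⟩ := RemoveOpposites.exists_removeOpposites (K.image (SignVec.reorient {i}) ∪
      {(R (k + 1)).reorient (Finset.Iic i), (R (k + 1)).reorient (Finset.Ici i)})
    exact ⟨K', .pass i K K' k hK hk label disj hK'⟩

end AlgorithmBuilds

theorem OrientedMatroid.IsSymmetricCycle.setOf_eq_image_cycle {m : ℕ}
    {N : OrientedMatroid (Fin m)} {R : ℕ → SignVec (Fin m)} (hR : N.IsMaximalChain R)
    {A : Finset (Fin m)} {T : ℕ → (N.reorient A).topes} (hT : (N.reorient A).IsSymmetricCycle T)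
    (hTR : ∀ k ≤ m, (T k : SignVec (Fin m)) = (R k).reorient A) :
    {X | ∃ k < 2 * m, X = (T k : SignVec (Fin m))} =
      SignVec.reorient A '' OrientedMatroid.IsMaximalChain.cycle R := by
  have hm := hT.three_le
  ext X
  constructor
  · rintro ⟨k, hk, rfl⟩
    by_cases hkm : k ≤ m
    · exact ⟨R k, ⟨k, hkm, Or.inl rfl⟩, (hTR k hkm).symm⟩
    · obtain ⟨j, rfl⟩ := Nat.exists_eq_add_of_lt (not_le.1 hkm)
      refine ⟨-R (j + 1), ⟨j + 1, by lia, Or.inr rfl⟩, ?_⟩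
      rw [SignVec.reorient_neg, ← hTR (j + 1) (by lia), ← hT.symm (j + 1) (by lia)]
      congr 2
      lia
  · rintro ⟨_, ⟨k, hk, rfl | rfl⟩, rfl⟩
    · exact ⟨k, by lia, (hTR k hk).symm⟩
    · rcases hk.lt_or_eq with hk | rfl
      · exact ⟨k + m, by lia, by rw [hT.symm k hk, hTR k hk.le, SignVec.reorient_neg]⟩
      -- For -R^m the index m + m is out of range, but -R^m = R^0.
      · refine ⟨0, by lia, ?_⟩
        rw [hTR 0 (Nat.zero_le _), hR.last_eq_neg_first, neg_neg]

theorem propositionp (m : ℕ) (N : OrientedMatroid (Fin m))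
    (hrank : 2 ≤ N.rank) (hsimple : N.IsSimple) (hacyclic : N.IsAcyclic)
    (R : ℕ → SignVec (Fin m)) (hR : N.IsMaximalChain R)
    (s : ℕ) (hs : 1 ≤ s) (hsm : s ≤ m)
    (T : ℕ → (N.reorient (OrientedMatroid.firstElements m s)).topes)
    (hT : (N.reorient (OrientedMatroid.firstElements m s)).IsSymmetricCycle T)
    (hTR : ∀ k ≤ m, (T k : SignVec (Fin m)) =
      (R k).reorient (OrientedMatroid.firstElements m s)) :
    (∃ K, AlgorithmBuilds R s K) ∧
    ∀ K, AlgorithmBuilds R s K →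
      (K : Set (SignVec (Fin m))) =
        SignVec.bmaxPos {X | ∃ k < 2 * m, X = (T k : SignVec (Fin m))} ∧
      (N.reorient (OrientedMatroid.firstElements m s)).IsCriticalTopeCommittee K := by
  have hm : 2 ≤ m := by have := hT.three_le; lia
  refine ⟨AlgorithmBuilds.exists_algorithmBuilds hR hsimple hm hsm, fun K hK => ?_⟩
  obtain ⟨hsub, hbal⟩ := AlgorithmBuilds.isBalanced hR hsimple hm hK
  have hP := (hR.isCornered_cycle hsimple (by lia)).image_reorient
    (OrientedMatroid.firstElements m s)
  rw [← hT.setOf_eq_image_cycle hR hTR] at hsub hP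
  refine ⟨hbal.coe_eq_bmaxPos hP hsub, hbal.isCriticalTopeCommittee hP hsub ?_⟩
  rintro _ ⟨k, -, rfl⟩
  exact (T k).2
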